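/- Let $\mathcal H$ and $\mathcal H_i$ ($i\in N$, $N$ a finite set of shares) be finite-dimensional complex Hilbert spaces, and write $\mathcal H_X=\bigotimes_{i\in X}\mathcal H_i$ for $X\subseteq N$. Let $\mathcal S(\cdot)$ denote the set of density operators on a space, and call a completely positive trace-preserving map a quantum operation. A quantum operation $\mathcal E$ from $\mathcal J$ to $\mathcal K$ is *reversible* (with respect to $\mathcal S(\mathcal J)$) if there is a quantum operation $\mathcal R$ from $\mathcal K$ to $\mathcal J$ with $\mathcal R(\mathcal E(\rho))=\rho$ for all $\rho\in\mathcal S(\mathcal J)$, and *vanishing* if there is $\rho_0\in\mathcal S(\mathcal K)$ with $\mathcal E(\rho)=\rho_0$ for all $\rho\in\mathcal S(\mathcal J)$. A *quantum secret sharing (QSS) scheme* is a reversible quantum operation $W_N$ from $\mathcal H$ to $\mathcal H_N$. For $X\subseteq N$ let $W_X=\mathrm{Tr}_{N\setminus X}\circ W_N$; the set $X$ is *qualified* if $W_X$ is reversible, *forbidden* if $W_X$ is vanishing, and *significant* if there is a forbidden set $Y\subseteq N$ such that $X\cup Y$ is qualified. Then for every QSS scheme $W_N$ and every share $i\in N$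 such that $\{i\}$ is significant, $$\dim\mathcal H\le\dim\mathcal H_i.$$ -/

import Mathlib

/-!
Finite-dimensional Hilbert spaces are written in a fixed orthonormal basis: a finite type `d`
of basis labels stands for the Hilbert space `EuclideanSpace ℂ d`, and linear operators on it are
matrices `Matrix d d ℂ`.  The tensor product of the spaces labelled by `e i` (`i ∈ X`) has the
product basis, labelled by the functions `(i : X) → e i`.
-/

open scoped ComplexOrder

/-- Density operators: positive semidefinite operators of trace one. -/
def densityOperators (d : Type*) [Fintype d] : Set (Matrix d d ℂ) :=
  {ρ | ρ.PosSemidef ∧ ρ.trace = 1}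

/-- The amplification `id_k ⊗ Φ`: the map `Φ` applied to each block of a block matrix. -/
def amplify {d e : Type*} (k : ℕ) (Φ : Matrix d d ℂ →ₗ[ℂ] Matrix e e ℂ)
    (M : Matrix (Fin k × d) (Fin k × d) ℂ) : Matrix (Fin k × e) (Fin k × e) ℂ :=
  Matrix.of fun p q => Φ (Matrix.of fun a b => M (p.1, a) (q.1, b)) p.2 q.2

/-- Complete positivity: every amplification preserves positive semidefiniteness. -/
def IsCompletelyPositive {d e : Type*} (Φ : Matrix d d ℂ →ₗ[ℂ] Matrix e e ℂ) : Prop :=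
  ∀ (k : ℕ) (M : Matrix (Fin k × d) (Fin k × d) ℂ), M.PosSemidef → (amplify k Φ M).PosSemidef

/-- Quantum operations: completely positive trace-preserving maps. -/
structure QuantumOperation (d e : Type*) [Fintype d] [Fintype e] where
  toLin : Matrix d d ℂ →ₗ[ℂ] Matrix e e ℂ
  completelyPositive : IsCompletelyPositive toLin
  tracePreserving : ∀ ρ : Matrix d d ℂ, (toLin ρ).trace = ρ.trace

namespace QuantumOperation

/-- Composition: first `E`, then `F`. -/
def comp {d e f : Type*} [Fintype d] [Fintype e] [Fintype f]
    (F : QuantumOperation e f) (E : QuantumOperation d e) : QuantumOperation d f where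
  toLin := F.toLin ∘ₗ E.toLin
  completelyPositive := fun k M hM =>
    F.completelyPositive k _ (E.completelyPositive k M hM)
  tracePreserving := fun ρ => by
    rw [LinearMap.comp_apply, F.tracePreserving, E.tracePreserving]

/-- `E` is reversible with respect to a set `S` of states. -/
def IsReversible {d e : Type*} [Fintype d] [Fintype e] (E : QuantumOperation d e)
    (S : Set (Matrix d d ℂ)) : Prop :=
  ∃ R : QuantumOperation e d, ∀ ρ ∈ S, R.toLin (E.toLin ρ) = ρ

/-- `E` is vanishing with respect to a set `S` of states. -/
def IsVanishing {d e : Type*} [Fintype d] [Fintype e] (E : QuantumOperation d e)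
    (S : Set (Matrix d d ℂ)) : Prop :=
  ∃ ρ₀ ∈ densityOperators e, ∀ ρ ∈ S, E.toLin ρ = ρ₀

end QuantumOperation

/-- The basis label of the whole system which is `a` on the shares in `X` and `c` on the others. -/
def joinLabels {N : Type*} [DecidableEq N] {e : N → Type*} (X : Finset N)
    (a : (i : {i // i ∈ X}) → e i) (c : (i : {i // i ∉ X}) → e i) : (i : N) → e i :=
  (Equiv.piEquivPiSubtypeProd (fun i => i ∈ X) e).symm (a, c)

/-- The partial trace over the complement of `X`, as a linear map. -/
noncomputable def partialTraceLin {N : Type*} [Fintype N] [DecidableEq N] (e : N → Type*)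
    [∀ i, Fintype (e i)] (X : Finset N) :
    Matrix ((i : N) → e i) ((i : N) → e i) ℂ →ₗ[ℂ]
      Matrix ((i : {i // i ∈ X}) → e i) ((i : {i // i ∈ X}) → e i) ℂ where
  toFun ρ := Matrix.of fun a b =>
    ∑ c : (i : {i // i ∉ X}) → e i, ρ (joinLabels X a c) (joinLabels X b c)
  map_add' := fun ρ σ => by
    ext a b
    simp [Finset.sum_add_distrib]
  map_smul' := fun z ρ => by
    ext a b
    simp [Finset.mul_sum]

/-- The partial trace over the complement of `X`, as a quantum operation. -/
noncomputable def partialTrace {N : Type*} [Fintype N] [DecidableEq N] (e : N → Type*)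
    [∀ i, Fintype (e i)] (X : Finset N) :
    QuantumOperation ((i : N) → e i) ((i : {i // i ∈ X}) → e i) where
  toLin := partialTraceLin e X
  completelyPositive := fun k M hM => by
    have h : amplify k (partialTraceLin e X) M =
        ∑ c : (i : {i // i ∉ X}) → e i,
          M.submatrix (fun p : Fin k × ((i : {i // i ∈ X}) → e i) => (p.1, joinLabels X p.2 c))
            (fun p => (p.1, joinLabels X p.2 c)) := by
      ext p q
      simp [amplify, partialTraceLin, Matrix.sum_apply]
    rw [h]
    exact Matrix.posSemidef_sum _ fun c _ => hM.submatrix _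
  tracePreserving := fun ρ => by
    simp only [Matrix.trace, Matrix.diag, partialTraceLin, LinearMap.coe_mk, AddHom.coe_mk,
      Matrix.of_apply]
    rw [← Fintype.sum_prod_type']
    exact Equiv.sum_comp (Equiv.piEquivPiSubtypeProd (fun i => i ∈ X) e).symm
      (fun x => ρ x x)

/-- A quantum secret sharing scheme encrypting states of `EuclideanSpace ℂ d` into the shares
`EuclideanSpace ℂ (e i)`, `i : N`: an encoding quantum operation that is reversible with respect
to all density operators. -/
structure QSSScheme (d : Type*) [Fintype d] {N : Type*} [Fintype N] [DecidableEq N]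
    (e : N → Type*) [∀ i, Fintype (e i)] where
  encoder : QuantumOperation d ((i : N) → e i)
  reversible : encoder.IsReversible (densityOperators d)

namespace QSSScheme

/-- The encoder followed by the partial trace over the complement of `X`. -/
noncomputable def reduced {d : Type*} [Fintype d] {N : Type*} [Fintype N] [DecidableEq N]
    {e : N → Type*} [∀ i, Fintype (e i)] (W : QSSScheme d e) (X : Finset N) :
    QuantumOperation d ((i : {i // i ∈ X}) → e i) :=
  (partialTrace e X).comp W.encoder

/-- The shares in `X` together determine the secret state. -/
def IsQualified {d : Type*} [Fintype d] {N : Type*} [Fintype N] [DecidableEq N]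
    {e : N → Type*} [∀ i, Fintype (e i)] (W : QSSScheme d e) (X : Finset N) : Prop :=
  (W.reduced X).IsReversible (densityOperators d)

/-- The shares in `X` together carry no information about the secret state. -/
def IsForbidden {d : Type*} [Fintype d] {N : Type*} [Fintype N] [DecidableEq N]
    {e : N → Type*} [∀ i, Fintype (e i)] (W : QSSScheme d e) (X : Finset N) : Prop :=
  (W.reduced X).IsVanishing (densityOperators d)

/-- `X` is significant if it turns some forbidden set into a qualified one. -/
def IsSignificant {d : Type*} [Fintype d] {N : Type*} [Fintype N] [DecidableEq N]
    {e : N → Type*} [∀ i, Fintype (e i)] (W : QSSScheme d e) (X : Finset N) : Prop :=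
  ∃ Y : Finset N, W.IsForbidden Y ∧ W.IsQualified (X ∪ Y)

end QSSScheme

/-!
Let `Y` be forbidden and `X ∪ Y` qualified, where `X` and `Y` may be taken disjoint. The Kraus
operators of the encoder assemble into a tensor with four legs: the secret `S`, the shares in `X`,
the shares in `Y`, and a leg `Z` for everything else (the remaining shares and the environment).
As `Y` is forbidden, its marginal is `M ↦ tr M • σ`, so the flattening of the tensor across
`SY | XZ` has rank `dim S * rank σ`. As `X ∪ Y` is qualified, the Knill-Laflamme conditions show
that `Z` learns nothing either: its marginal is `M ↦ tr M • τ`, and the flattening across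
`Z | SXY` has rank at most `rank τ`. Moving the leg `X` across the cut multiplies the rank by at
most `dim X`, so `dim S * rank σ ≤ dim X * rank τ`. Exchanging the roles of `Y` and `Z` gives
`dim S * rank τ ≤ dim X * rank σ`, and together `dim S ^ 2 ≤ dim X ^ 2`.
-/

open Matrix Kronecker

section Rank

variable {K : Type*} [Field K]

theorem finrank_submodule_pi_const {V : Type*} [AddCommGroup V] [Module K V] (t : Type*) [Fintype t]
    (S : Submodule K V) [Module.Finite K S] :
    Module.finrank K (Submodule.pi (Set.univ : Set t) fun _ => S) =
      Fintype.card t * Module.finrank K S := by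
  have hinj : Function.Injective (S.subtype.compLeft t) :=
    S.subtype_injective.comp_left
  have h := LinearMap.finrank_range_of_inj hinj
  rw [LinearMap.range_compLeft, Submodule.range_subtype] at h
  simp [h, Module.finrank_pi_fintype]

variable {m n p t : Type*} [Fintype n] [Fintype p] [Fintype t]

theorem rank_one_kronecker [DecidableEq t] (A : Matrix m n K) :
    ((1 : Matrix t t K) ⊗ₖ A).rank = Fintype.card t * A.rank := by
  have hcurry : (LinearEquiv.curry K K t m).toLinearMap ∘ₗ ((1 : Matrix t t K) ⊗ₖ A).mulVecLin =
      A.mulVecLin.compLeft t ∘ₗ (LinearEquiv.curry K K t n).toLinearMap := by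
    ext
    simp [Matrix.mulVec, dotProduct, Fintype.sum_prod_type, one_apply]
  calc ((1 : Matrix t t K) ⊗ₖ A).rank
    _ = Module.finrank K (A.mulVecLin.compLeft t).range := by
      rw [rank, ← LinearEquiv.finrank_map_eq (LinearEquiv.curry K K t m), ← LinearMap.range_comp,
        hcurry, LinearMap.range_comp_of_range_eq_top _ (LinearEquiv.range _)]
    _ = Fintype.card t * A.rank := by
      rw [LinearMap.range_compLeft, finrank_submodule_pi_const, rank]

theorem rank_le_card_mul_rank_of_slices [Finite m] (A : Matrix (t × m) n K) (B : Matrix m p K)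
    (h : ∀ b j, ∃ l, ∀ i, A (b, i) j = B i l) : A.rank ≤ Fintype.card t * B.rank := by
  have hslice : ∀ b v, (fun i => (A *ᵥ v) (b, i)) ∈ B.mulVecLin.range := by
    classical
    intro b v
    choose l hl using h b
    refine ⟨∑ j, v j • Pi.single (l j) 1, funext fun i => ?_⟩
    simp [mulVec, dotProduct, hl, mul_comm]
  calc A.rank
    _ = Module.finrank K (A.mulVecLin.range.map (LinearEquiv.curry K K t m).toLinearMap) :=
      (LinearEquiv.finrank_map_eq _ _).symm
    _ ≤ Module.finrank K (Submodule.pi (Set.univ : Set t) fun _ => B.mulVecLin.range) := by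
      refine Submodule.finrank_mono ?_
      rintro _ ⟨_, ⟨v, rfl⟩, rfl⟩ b -
      exact hslice b v
    _ = Fintype.card t * B.rank := by rw [finrank_submodule_pi_const, rank]

theorem rank_pos_of_ne_zero {A : Matrix m n K} (hA : A ≠ 0) : 0 < A.rank := by
  classical
  refine Nat.pos_of_ne_zero fun h => hA ?_
  rw [rank, Submodule.finrank_eq_zero, LinearMap.range_eq_bot] at h
  exact Matrix.toLin'.injective (by rw [toLin'_apply', h, map_zero])

theorem rank_smul_le (c : K) (A : Matrix m n K) : (c • A).rank ≤ A.rank := by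
  classical
  simpa using rank_mul_le_left A (c • (1 : Matrix n n K))

end Rank

open MatrixOrder Matrix.Norms.L2Operator in
theorem span_posSemidef (d : Type*) [Finite d] :
    Submodule.span ℂ {M : Matrix d d ℂ | M.PosSemidef} = ⊤ := by
  classical
  have := Fintype.ofFinite d
  simpa only [Matrix.nonneg_iff_posSemidef] using CStarAlgebra.span_nonneg (A := Matrix d d ℂ)

theorem span_densityOperators (d : Type*) [Fintype d] :
    Submodule.span ℂ (densityOperators d) = ⊤ := by
  rw [eq_top_iff, ← span_posSemidef, Submodule.span_le]
  intro M hM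
  by_cases h : M.trace = 0
  · simp [hM.trace_eq_zero_iff.mp h]
  · have : M.trace⁻¹ • M ∈ densityOperators d :=
      ⟨hM.smul (inv_nonneg_of_nonneg hM.trace_nonneg), by simp [h]⟩
    rw [← smul_inv_smul₀ h M]
    exact Submodule.smul_mem _ _ (Submodule.subset_span this)

/-- The completely positive map with Kraus operators `K k`. No normalization is imposed, so it need
not preserve the trace. -/
def krausMap {κ d e : Type*} [Fintype κ] [Fintype d] (K : κ → Matrix e d ℂ) :
    Matrix d d ℂ →ₗ[ℂ] Matrix e e ℂ where
  toFun M := ∑ k, K k * M * (K k)ᴴ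
  map_add' M M' := by simp only [Matrix.mul_add, Matrix.add_mul, Finset.sum_add_distrib]
  map_smul' c M := by
    simp only [Matrix.mul_smul, Matrix.smul_mul, Finset.smul_sum, RingHom.id_apply]

/-- The Kraus operators of the complementary channel: the output index and the environment index
of the Stinespring tensor `K k i s` swap roles. -/
def complementaryKraus {κ d e : Type*} (K : κ → Matrix e d ℂ) : e → Matrix κ d ℂ :=
  fun i => of fun k s => K k i s

section Kraus

variable {κ d e : Type*} [Fintype d]

theorem krausMap_complementaryKraus_apply [Fintype e] (K : κ → Matrix e d ℂ) (M : Matrix d d ℂ)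
    (k l : κ) :
    krausMap (complementaryKraus K) M k l = (M * ((K l)ᴴ * K k)).trace := by
  rw [← Matrix.mul_assoc, trace_mul_comm, ← Matrix.mul_assoc]
  simp [krausMap, Matrix.sum_apply, Matrix.mul_apply, complementaryKraus, trace]

variable [Fintype κ]

theorem krausMap_apply (K : κ → Matrix e d ℂ) (M : Matrix d d ℂ) :
    krausMap K M = ∑ k, K k * M * (K k)ᴴ := rfl

theorem krausMap_single_apply [DecidableEq d] (K : κ → Matrix e d ℂ) (s s' : d) (i j : e) :
    krausMap K (single s s' 1) i j = ∑ k, K k i s * star (K k j s') := by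
  simp [krausMap_apply, Matrix.sum_apply, Matrix.mul_apply, single_apply, ite_and]

theorem krausMap_comp_equiv {κ' : Type*} [Fintype κ'] (f : κ' ≃ κ) (K : κ → Matrix e d ℂ) :
    krausMap (K ∘ f) = krausMap K :=
  LinearMap.ext fun M => f.sum_comp fun k => K k * M * (K k)ᴴ

theorem IsCompletelyPositive.exists_apply_single_eq_sum {d e : Type*} [Finite d] [Finite e]
    [DecidableEq d]
    {Φ : Matrix d d ℂ →ₗ[ℂ] Matrix e e ℂ} (hΦ : IsCompletelyPositive Φ) :
    ∃ (n : ℕ) (K : Fin n → Matrix e d ℂ), ∀ s s' i j,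
      Φ (single s s' 1) i j = ∑ k, K k i s * star (K k j s') := by
  have f := Finite.equivFin d
  -- The unnormalized maximally entangled vector: amplifying `Φ` on it gives the Choi matrix.
  let ω : Fin (Nat.card d) × d → ℂ := fun p => if p.1 = f p.2 then 1 else 0
  have hchoi : ∀ s s' i j, amplify _ Φ (vecMulVec ω (star ω)) (f s, i) (f s', j) =
      Φ (single s s' 1) i j := by
    intro s s' i j
    have : (of fun a b => vecMulVec ω (star ω) (f s, a) (f s', b)) = single s s' 1 := by
      ext a b
      simp only [of_apply, vecMulVec_apply, Pi.star_apply, ω, single_apply,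
        EmbeddingLike.apply_eq_iff_eq]
      split_ifs <;> simp_all
    simp only [amplify, of_apply, this]
  obtain ⟨n, B, hB⟩ := posSemidef_iff_eq_sum_vecMulVec.mp
    (hΦ _ _ (posSemidef_vecMulVec_self_star ω))
  refine ⟨n, fun k => of fun i s => B k (f s, i), fun s s' i j => ?_⟩
  simp [← hchoi, hB, Matrix.sum_apply, vecMulVec_apply]

theorem IsCompletelyPositive.exists_eq_krausMap [Finite e]
    {Φ : Matrix d d ℂ →ₗ[ℂ] Matrix e e ℂ} (hΦ : IsCompletelyPositive Φ) :
    ∃ (n : ℕ) (K : Fin n → Matrix e d ℂ), Φ = krausMap K := by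
  classical
  obtain ⟨n, K, hK⟩ := hΦ.exists_apply_single_eq_sum
  refine ⟨n, K, Matrix.ext_linearMap ℂ fun s s' => LinearMap.ext_ring (Matrix.ext fun i j => ?_)⟩
  simpa [krausMap_single_apply] using hK s s' i j

end Kraus

open MatrixOrder in
theorem eq_zero_of_sum_mul_conjTranspose_eq_zero {κ m n : Type*} [Fintype κ] [Finite m]
    [Fintype n] {A : κ → Matrix m n ℂ} (h : ∑ k, A k * (A k)ᴴ = 0) (k : κ) : A k = 0 := by
  have := Fintype.ofFinite m
  have h0 := (Finset.sum_eq_zero_iff_of_nonneg fun k _ =>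
    (posSemidef_self_mul_conjTranspose (A k)).nonneg).mp h k (Finset.mem_univ k)
  exact self_mul_conjTranspose_eq_zero.mp h0

theorem exists_eq_smul_one_of_krausMap_eq_id {κ d : Type*} [Fintype κ] [Fintype d]
    [DecidableEq d] {F : κ → Matrix d d ℂ} (h : krausMap F = LinearMap.id) (k : κ) :
    ∃ c : ℂ, F k = c • 1 := by
  have hid (M : Matrix d d ℂ) : ∑ k, F k * M * (F k)ᴴ = M := LinearMap.congr_fun h M
  have hcomm (M : Matrix d d ℂ) : F k * M - M * F k = 0 := by
    -- The map fixes `1`, `M`, `Mᴴ` and `M * Mᴴ`, so the squared commutators sum to zero.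
    refine eq_zero_of_sum_mul_conjTranspose_eq_zero (A := fun k => F k * M - M * F k) ?_ k
    calc
      ∑ k, (F k * M - M * F k) * (F k * M - M * F k)ᴴ
        = ∑ k, F k * (M * Mᴴ) * (F k)ᴴ - (∑ k, F k * M * (F k)ᴴ) * Mᴴ
          - M * (∑ k, F k * Mᴴ * (F k)ᴴ) + M * (∑ k, F k * 1 * (F k)ᴴ) * Mᴴ := by
        simp only [Finset.mul_sum, Finset.sum_mul, ← Finset.sum_sub_distrib,
          ← Finset.sum_add_distrib]
        refine Finset.sum_congr rfl fun k _ => ?_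
        simp only [conjTranspose_sub, conjTranspose_mul]
        noncomm_ring
      _ = 0 := by simp only [hid]; simp
  obtain ⟨c, hc⟩ := mem_range_scalar_of_commute_single fun i j _ =>
    (sub_eq_zero.mp (hcomm (single i j 1))).symm
  exact ⟨c, by rw [← hc, scalar_apply, smul_one_eq_diagonal]⟩

/-- The Stinespring tensor `K k i s`, flattened along its output index `i`: the Kraus operators
written side by side. -/
def rowFlattening {κ d e : Type*} (K : κ → Matrix e d ℂ) : Matrix e (κ × d) ℂ :=
  of fun i p => K p.1 i p.2

/-- The Stinespring tensor `K k i s`, flattened along its environment index `k`. -/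
def vecFlattening {κ d e : Type*} (K : κ → Matrix e d ℂ) : Matrix κ (d × e) ℂ :=
  of fun k => vec (K k)

/-- Kraus operators of the channel with Kraus operators `V k` followed by the partial trace over
the complement of `X`: the traced-out labels join the Kraus index. -/
def reducedKraus {N : Type*} [DecidableEq N] {e : N → Type*} {κ d : Type*} (X : Finset N)
    (V : κ → Matrix ((i : N) → e i) d ℂ) :
    ((i : {i // i ∉ X}) → e i) × κ → Matrix ((i : {i // i ∈ X}) → e i) d ℂ :=
  fun p => (V p.2).submatrix (fun a => joinLabels X a p.1) id

section Flattening

variable {κ d e : Type*} [Fintype κ] [Fintype d] {K : κ → Matrix e d ℂ} {σ : Matrix e e ℂ}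

theorem rowFlattening_mul_conjTranspose [DecidableEq d] (K : κ → Matrix e d ℂ) :
    rowFlattening K * (rowFlattening K)ᴴ = krausMap K 1 := by
  ext i j
  simp [rowFlattening, krausMap_apply, Matrix.mul_apply, Matrix.sum_apply, Fintype.sum_prod_type]

theorem rank_rowFlattening_le [Fintype e] (hK : ∀ M, krausMap K M = M.trace • σ) :
    (rowFlattening K).rank ≤ σ.rank := by
  classical
  rw [← rank_self_mul_conjTranspose, rowFlattening_mul_conjTranspose, hK]
  exact rank_smul_le _ _

theorem vecFlattening_transpose_mul_conjTranspose [DecidableEq d]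
    (hK : ∀ M, krausMap K M = M.trace • σ) :
    (vecFlattening K)ᵀ * (vecFlattening K)ᵀᴴ = (1 : Matrix d d ℂ) ⊗ₖ σ := by
  ext ⟨s, i⟩ ⟨s', j⟩
  have h := congrFun (congrFun (hK (single s s' 1)) i) j
  rw [krausMap_single_apply] at h
  by_cases hs : s = s'
  · subst hs
    simpa [vecFlattening, Matrix.mul_apply] using h
  · simpa [vecFlattening, Matrix.mul_apply, hs] using h

theorem rank_vecFlattening [Fintype e] (hK : ∀ M, krausMap K M = M.trace • σ) :
    (vecFlattening K).rank = Fintype.card d * σ.rank := by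
  classical
  rw [← rank_transpose, ← rank_self_mul_conjTranspose,
    vecFlattening_transpose_mul_conjTranspose hK, rank_one_kronecker]

end Flattening

section Tripartite

variable {s t y z : Type*} [Fintype s] [Fintype t] [Fintype y] [Fintype z]
  {K : t × z → Matrix y s ℂ} {L : t × y → Matrix z s ℂ} {σ : Matrix y y ℂ} {τ : Matrix z z ℂ}

theorem card_mul_rank_le_card_mul_rank (hKL : ∀ b k i c, K (b, k) i c = L (b, i) k c)
    (hK : ∀ M, krausMap K M = M.trace • σ) (hL : ∀ M, krausMap L M = M.trace • τ) :
    Fintype.card s * σ.rank ≤ Fintype.card t * τ.rank :=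
  calc Fintype.card s * σ.rank
    _ = (vecFlattening K).rank := (rank_vecFlattening hK).symm
    _ ≤ Fintype.card t * (rowFlattening L).rank :=
      rank_le_card_mul_rank_of_slices _ _ fun b p => ⟨((b, p.2), p.1), fun k => hKL b k p.2 p.1⟩
    _ ≤ Fintype.card t * τ.rank := Nat.mul_le_mul_left _ (rank_rowFlattening_le hL)

theorem card_le_card_of_krausMap_eq_trace_smul (hKL : ∀ b k i c, K (b, k) i c = L (b, i) k c)
    (hK : ∀ M, krausMap K M = M.trace • σ) (hL : ∀ M, krausMap L M = M.trace • τ) (hσ : σ ≠ 0) :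
    Fintype.card s ≤ Fintype.card t := by
  have hστ := card_mul_rank_le_card_mul_rank hKL hK hL
  have hτσ := card_mul_rank_le_card_mul_rank (fun b i k c => (hKL b k i c).symm) hL hK
  have hsq : Fintype.card s * Fintype.card s * σ.rank ≤
      Fintype.card t * Fintype.card t * σ.rank := by
    calc Fintype.card s * Fintype.card s * σ.rank
      _ = Fintype.card s * (Fintype.card s * σ.rank) := Nat.mul_assoc ..
      _ ≤ Fintype.card s * (Fintype.card t * τ.rank) := Nat.mul_le_mul_left _ hστ
      _ = Fintype.card t * (Fintype.card s * τ.rank) := Nat.mul_left_comm ..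
      _ ≤ Fintype.card t * (Fintype.card t * σ.rank) := Nat.mul_le_mul_left _ hτσ
      _ = Fintype.card t * Fintype.card t * σ.rank := (Nat.mul_assoc ..).symm
  exact Nat.mul_self_le_mul_self_iff.mp (Nat.le_of_mul_le_mul_right hsq (rank_pos_of_ne_zero hσ))

end Tripartite

section KnillLaflamme

variable {ι κ d e f : Type*} [Fintype ι] [Fintype κ] [Fintype d] [Fintype e]

theorem krausMap_comp (K : ι → Matrix f e ℂ) (E : κ → Matrix e d ℂ) :
    krausMap K ∘ₗ krausMap E = krausMap fun p : ι × κ => K p.1 * E p.2 := by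
  ext1 M
  simp only [LinearMap.comp_apply, krausMap_apply, Fintype.sum_prod_type, conjTranspose_mul,
    Matrix.mul_sum, Matrix.sum_mul, Matrix.mul_assoc]

theorem sum_conjTranspose_mul_self_eq_one [DecidableEq e] [Fintype f] {K : ι → Matrix f e ℂ}
    (hK : ∀ M, (krausMap K M).trace = M.trace) : ∑ k, (K k)ᴴ * K k = 1 := by
  refine ext_iff_trace_mul_right.mpr fun M => ?_
  rw [Matrix.one_mul]
  calc ((∑ k, (K k)ᴴ * K k) * M).trace
    _ = (krausMap K M).trace := by
      simp only [krausMap_apply, Matrix.sum_mul, trace_sum]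
      exact Finset.sum_congr rfl fun k _ => by rw [Matrix.mul_assoc, trace_mul_comm]
    _ = M.trace := hK M

theorem exists_conjTranspose_mul_eq_smul_one [DecidableEq d] {E : κ → Matrix e d ℂ}
    (R : QuantumOperation e d) (hR : R.toLin ∘ₗ krausMap E = LinearMap.id) (k l : κ) :
    ∃ c : ℂ, (E l)ᴴ * E k = c • 1 := by
  classical
  obtain ⟨n, K, hK⟩ := R.completelyPositive.exists_eq_krausMap
  rw [hK, krausMap_comp] at hR
  choose c hc using exists_eq_smul_one_of_krausMap_eq_id hR
  have hone : ∑ r, (K r)ᴴ * K r = 1 := sum_conjTranspose_mul_self_eq_one (hK ▸ R.tracePreserving)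
  refine ⟨∑ r, star (c (r, l)) * c (r, k), ?_⟩
  calc (E l)ᴴ * E k
    _ = (E l)ᴴ * (∑ r, (K r)ᴴ * K r) * E k := by rw [hone, Matrix.mul_one]
    _ = ∑ r, (K r * E l)ᴴ * (K r * E k) := by
      simp only [Matrix.mul_sum, Matrix.sum_mul, conjTranspose_mul, Matrix.mul_assoc]
    _ = ∑ r, (star (c (r, l)) * c (r, k)) • (1 : Matrix d d ℂ) :=
      Finset.sum_congr rfl fun r _ => by
        rw [hc (r, l), hc (r, k), conjTranspose_smul, conjTranspose_one, smul_one_mul, smul_smul]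
    _ = (∑ r, star (c (r, l)) * c (r, k)) • 1 := (Finset.sum_smul ..).symm

theorem exists_krausMap_complementaryKraus_eq_trace_smul {E : κ → Matrix e d ℂ}
    (R : QuantumOperation e d) (hR : R.toLin ∘ₗ krausMap E = LinearMap.id) :
    ∃ τ : Matrix κ κ ℂ, ∀ M, krausMap (complementaryKraus E) M = M.trace • τ := by
  classical
  choose τ hτ using exists_conjTranspose_mul_eq_smul_one R hR
  refine ⟨of τ, fun M => Matrix.ext fun k l => ?_⟩
  rw [krausMap_complementaryKraus_apply, hτ]
  simp [mul_comm]

end KnillLaflamme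

section Operation

variable {d e : Type*} [Fintype d] [Fintype e] {E : QuantumOperation d e}

theorem QuantumOperation.IsVanishing.exists_forall_toLin_eq_trace_smul
    (h : E.IsVanishing (densityOperators d)) :
    ∃ σ ∈ densityOperators e, ∀ M, E.toLin M = M.trace • σ := by
  obtain ⟨σ, hσ, h⟩ := h
  have : E.toLin = (traceLinearMap d ℂ ℂ).smulRight σ :=
    LinearMap.ext_on (span_densityOperators d) fun ρ hρ => by simp [h ρ hρ, hρ.2]
  exact ⟨σ, hσ, LinearMap.congr_fun this⟩

theorem QuantumOperation.IsReversible.exists_toLin_comp_toLin_eq_id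
    (h : E.IsReversible (densityOperators d)) :
    ∃ R : QuantumOperation e d, R.toLin ∘ₗ E.toLin = LinearMap.id := by
  obtain ⟨R, h⟩ := h
  exact ⟨R, LinearMap.ext_on (span_densityOperators d) h⟩

end Operation

section Shares

variable {N : Type*} [DecidableEq N] {e : N → Type*} {X Y : Finset N}

theorem joinLabels_apply (X : Finset N) (a : (i : {i // i ∈ X}) → e i)
    (c : (i : {i // i ∉ X}) → e i) (j : N) :
    joinLabels X a c j = if h : j ∈ X then a ⟨j, h⟩ else c ⟨j, h⟩ := rfl

/-- Basis labels of the shares outside `Y`, split into those in `X` and those outside `X ∪ Y`; this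
separates the legs `X` and `Z` of the environment of `Y`. -/
def complLabelsEquiv (h : Disjoint X Y) :
    ((j : {j // j ∈ X}) → e j) × ((j : {j // j ∉ X ∪ Y}) → e j) ≃
      ((j : {j // j ∉ Y}) → e j) where
  toFun p j := if hj : j.1 ∈ X then p.1 ⟨j, hj⟩ else p.2 ⟨j, by simp [hj, j.2]⟩
  invFun f := (fun j => f ⟨j, Finset.disjoint_left.mp h j.2⟩,
    fun j => f ⟨j, fun hj => j.2 (Finset.mem_union_right X hj)⟩)
  left_inv p := by
    refine Prod.ext (funext fun j => dif_pos j.2) (funext fun j => dif_neg fun hj => ?_)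
    exact j.2 (Finset.mem_union_left Y hj)
  right_inv f := by
    ext j
    by_cases hj : j.1 ∈ X
    · exact dif_pos hj
    · exact dif_neg hj

theorem joinLabels_union (h : Disjoint X Y) (a : (j : {j // j ∈ X}) → e j)
    (b : (j : {j // j ∈ Y}) → e j) (c : (j : {j // j ∉ X ∪ Y}) → e j) :
    joinLabels (X ∪ Y) (Equiv.piFinsetUnion e h (a, b)) c =
      joinLabels Y b (complLabelsEquiv h (a, c)) := by
  ext j
  simp only [joinLabels_apply, complLabelsEquiv, Equiv.coe_fn_mk]
  by_cases hX : j ∈ X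
  · have hY : j ∉ Y := Finset.disjoint_left.mp h hX
    simp [hX, hY, Equiv.piFinsetUnion_left e h hX]
  · by_cases hY : j ∈ Y
    · simp [hY, Equiv.piFinsetUnion_right e h hY]
    · simp [hX, hY]

theorem card_labels_le_of_subset [∀ i, Fintype (e i)] [∀ i, Nonempty (e i)] (h : X ⊆ Y) :
    Fintype.card ((i : {i // i ∈ X}) → e i) ≤ Fintype.card ((i : {i // i ∈ Y}) → e i) := by
  simp only [Fintype.card_pi]
  rw [Finset.prod_coe_sort X fun i => Fintype.card (e i),
    Finset.prod_coe_sort Y fun i => Fintype.card (e i)]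
  exact Finset.prod_le_prod_of_subset_of_one_le' h fun i _ _ => Fintype.card_pos

variable {κ d : Type*} [Fintype κ] [Fintype d] [Fintype N] [∀ i, Fintype (e i)]

theorem partialTraceLin_comp_krausMap (X : Finset N) (V : κ → Matrix ((i : N) → e i) d ℂ) :
    partialTraceLin e X ∘ₗ krausMap V = krausMap (reducedKraus X V) := by
  ext1 M
  ext a b
  simp [partialTraceLin, krausMap_apply, reducedKraus, Matrix.sum_apply, Matrix.mul_apply,
    Fintype.sum_prod_type]

end Shares

theorem QuantumOperation.nonempty {d e : Type*} [Fintype d] [Fintype e] [Nonempty d]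
    (E : QuantumOperation d e) : Nonempty e := by
  classical
  by_contra! he
  obtain ⟨a⟩ := ‹Nonempty d›
  simpa [trace] using E.tracePreserving (single a a 1)

namespace QSSScheme

variable {d : Type*} [Fintype d] {N : Type*} [Fintype N] [DecidableEq N] {e : N → Type*}
  [∀ i, Fintype (e i)] {X Y : Finset N}

theorem card_le_card_labels_of_disjoint (W : QSSScheme d e) (h : Disjoint X Y)
    (hY : W.IsForbidden Y) (hXY : W.IsQualified (X ∪ Y)) :
    Fintype.card d ≤ Fintype.card ((i : {i // i ∈ X}) → e i) := by
  obtain ⟨n, V, hV⟩ := W.encoder.completelyPositive.exists_eq_krausMap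
  have hred (Z : Finset N) : (W.reduced Z).toLin = krausMap (reducedKraus Z V) := by
    rw [← partialTraceLin_comp_krausMap, ← hV]
    rfl
  obtain ⟨σ, hσ, hforbidden⟩ := hY.exists_forall_toLin_eq_trace_smul
  obtain ⟨R, hR⟩ := hXY.exists_toLin_comp_toLin_eq_id
  rw [hred] at hR
  obtain ⟨τ, hτ⟩ := exists_krausMap_complementaryKraus_eq_trace_smul R hR
  let labels := (Equiv.prodAssoc _ _ (Fin n)).symm.trans
    ((complLabelsEquiv (e := e) h).prodCongr (Equiv.refl (Fin n)))
  refine card_le_card_of_krausMap_eq_trace_smul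
    (K := reducedKraus Y V ∘ labels)
    (L := complementaryKraus (reducedKraus (X ∪ Y) V) ∘ Equiv.piFinsetUnion e h)
    (σ := σ) (τ := τ) ?_ ?_ ?_ ?_
  · intro a k b c
    exact congrArg (V k.2 · c) (joinLabels_union h a b k.1).symm
  · rwa [krausMap_comp_equiv, ← hred]
  · rwa [krausMap_comp_equiv]
  · rintro rfl
    simpa using hσ.2

end QSSScheme

theorem corollary1_general {d : Type*} [Fintype d] {N : Type*} [Fintype N] [DecidableEq N]
    {e : N → Type*} [∀ i, Fintype (e i)] (W : QSSScheme d e) (X : Finset N)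
    (hX : W.IsSignificant X) :
    Module.finrank ℂ (EuclideanSpace ℂ d) ≤
      Module.finrank ℂ (EuclideanSpace ℂ ((i : {i // i ∈ X}) → e i)) := by
  rw [finrank_euclideanSpace, finrank_euclideanSpace]
  obtain ⟨Y, hY, hXY⟩ := hX
  cases isEmpty_or_nonempty d with
  | inl _ => simp
  | inr _ =>
    have := Classical.nonempty_pi.mp W.encoder.nonempty
    rw [← Finset.sdiff_union_self_eq_union] at hXY
    calc Fintype.card d
      _ ≤ Fintype.card ((i : {i // i ∈ X \ Y}) → e i) :=
        W.card_le_card_labels_of_disjoint Finset.sdiff_disjoint hY hXY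
      _ ≤ Fintype.card ((i : {i // i ∈ X}) → e i) := card_labels_le_of_subset Finset.sdiff_subset

theorem corollary1 {d : Type*} [Fintype d] {N : Type*} [Fintype N] [DecidableEq N]
    {e : N → Type*} [∀ i, Fintype (e i)] (W : QSSScheme d e) (i : N)
    (hi : W.IsSignificant {i}) :
    Module.finrank ℂ (EuclideanSpace ℂ d) ≤ Module.finrank ℂ (EuclideanSpace ℂ (e i)) := by
  simpa [Fintype.card_pi] using corollary1_general W {i} hi
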